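/- Let $L$ be a multiplicative lattice, i.e. a complete lattice with smallest element $0$ and largest element $1$, together with a commutative associative multiplication such that $1x=x$ and $x\bigvee E=\bigvee\{xe\mid e\in E\}$ for all $x\in L$ and $E\subseteq L$. For $a,b\in L$ put $(a:b)=\bigvee\{x\in L\mid xb\le a\}$. An element $e\in L$ is principal if $a\wedge be=((a:e)\wedge b)e$ and $((a\vee be):e)=(a:e)\vee b$ for all $a,b\in L$. An element $a$ is compact if $a\le\bigvee F$ with $F\subseteq L$ implies $a\le\bigvee E$ for some finite $E\subseteq F$. An element $x<1$ is called - prime if for all $a,b\in L$, $ab\le x$ implies $a\le x$ or $b\le x$; - an OA-element if for all $a,b,c\in L\setminus\{1\}$, $abc\le x$ implies $ab\le x$ or $c\le x$; - a TA-element if for all $a,b,c\in L$, $abc\le x$ implies $ab\le x$ or $ac\le x$ or $bc\le x$. An OA-factorization (resp. TA-factorization) of an element is an expression of it as a finite (possibly empty) product of OA-elements (resp. TA-elements), the empty product being $1$. $L$ is an OAFL (resp. COAFL, resp. POAFL) if every element (resp. every compact element, resp. every principal element) of $L$ has an OA-factorization; TAFL, CTAFL and PTAFL are defined likewise with TA-factorizations.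 The dimension $\dim(L)$ is the supremum of the lengths $n$ of strict chains $p_0<p_1<\dots<p_n$ of prime elements. An element $a$ is comparable if $a\le b$ or $b\le a$ for every $b\in L$. Theorem. Let $L$ be a multiplicative lattice such that - $L$ is a C-lattice, i.e. some set of compact elements that contains $1$ and is closed under multiplication generates $L$ under joins; - $L$ is principally generated, i.e. every element is a join of principal elements; - $L$ is a lattice domain, i.e. $0$ is prime; - $L$ is quasi-local with maximal element $m$, i.e. $1$ is compact and $m$ is the unique maximal element among the elements $<1$. Then the following statements are equivalent. 1. $L$ is an OAFL. 2. $L$ is a TAFL. 3. $L$ is a COAFL. 4. $L$ is a CTAFL that satisfies the ascending chain condition on prime elements. 5. $\dim(L)\le 1$ and $L$ is a POAFL. 6. $\dim(L)\le 1$ and $L$ is a PTAFL. 7. $\dim(L)\le 1$, $m^2$ is comparable and $\bigwedge_{n\in\mathbb{N}} m^n=0$. -/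

import Mathlib

/-- A multiplicative lattice: a complete lattice with a commutative multiplication which
distributes over arbitrary joins (this is `IsQuantale`) and whose identity is the largest element.
The smallest element `0` of such a lattice is `⊥`. -/
class IsMultiplicativeLattice (L : Type*) [CommMonoid L] [CompleteLattice L] : Prop
    extends IsQuantale L where
  one_eq_top : (1 : L) = ⊤

namespace MultLattice

section Elements

variable {L : Type*} [CommMonoid L] [CompleteLattice L]

/-- The residual `(a : b)`. -/
def residual (a b : L) : L := sSup {x | x * b ≤ a}

/-- `a ∧ be = ((a : e) ∧ b)e` for all `a, b`. -/
def IsMeetPrincipal (e : L) : Prop :=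
  ∀ a b : L, a ⊓ b * e = (residual a e ⊓ b) * e

/-- `((a ∨ be) : e) = (a : e) ∨ b` for all `a, b`. -/
def IsJoinPrincipal (e : L) : Prop :=
  ∀ a b : L, residual (a ⊔ b * e) e = residual a e ⊔ b

/-- Principal elements (in the sense of Dilworth). -/
def IsPrincipalElt (e : L) : Prop := IsMeetPrincipal e ∧ IsJoinPrincipal e

/-- A proper element `p` such that `ab ≤ p` implies `a ≤ p` or `b ≤ p`. -/
def IsPrimeElt (p : L) : Prop :=
  p < ⊤ ∧ ∀ a b : L, a * b ≤ p → a ≤ p ∨ b ≤ p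

/-- OA-elements, that is, 1-absorbing prime elements. -/
def IsOAElt (x : L) : Prop :=
  x < ⊤ ∧ ∀ a b c : L, a ≠ ⊤ → b ≠ ⊤ → c ≠ ⊤ → a * b * c ≤ x → a * b ≤ x ∨ c ≤ x

/-- TA-elements, that is, 2-absorbing elements. -/
def IsTAElt (x : L) : Prop :=
  x < ⊤ ∧ ∀ a b c : L, a * b * c ≤ x → a * b ≤ x ∨ a * c ≤ x ∨ b * c ≤ x

/-- `x` is a finite product of elements satisfying `P`; the empty product is `1`. -/
def HasFactorization (P : L → Prop) (x : L) : Prop :=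
  ∃ s : Multiset L, (∀ y ∈ s, P y) ∧ s.prod = x

/-- An element comparable to every element of the lattice. -/
def IsComparableElt (a : L) : Prop := ∀ b : L, a ≤ b ∨ b ≤ a

end Elements

section Lattices

variable (L : Type*) [CommMonoid L] [CompleteLattice L]

/-- The lattice is generated under joins by a multiplicatively closed set of compact elements. -/
def IsCLattice : Prop :=
  ∃ C : Submonoid L, (∀ c ∈ C, IsCompactElement c) ∧
    ∀ x : L, ∃ S : Set L, S ⊆ (C : Set L) ∧ sSup S = x

/-- Every element is a join of principal elements. -/
def IsPrincipallyGenerated : Prop :=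
  ∀ x : L, ∃ S : Set L, (∀ e ∈ S, IsPrincipalElt e) ∧ sSup S = x

/-- The smallest element is prime. -/
def IsLatticeDomain : Prop := IsPrimeElt (⊥ : L)

/-- `(L, m)` is quasi-local: `1` is compact and `m` is the unique maximal element. -/
def IsQuasiLocal (m : L) : Prop :=
  IsCompactElement (1 : L) ∧ IsCoatom m ∧ ∀ n : L, IsCoatom n → n = m

/-- The dimension: the supremum of the lengths of strict chains of prime elements. -/
noncomputable def dim : WithBot ℕ∞ := Order.krullDim {p : L // IsPrimeElt p}

/-- Every ascending chain of prime elements becomes stationary. -/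
def ACCOnPrimes : Prop :=
  ∀ f : ℕ → L, (∀ n, IsPrimeElt (f n)) → Monotone f → ∃ n, ∀ k, n ≤ k → f k = f n

/-- Every element has an OA-factorization. -/
def IsOAFL : Prop := ∀ x : L, HasFactorization IsOAElt x

/-- Every compact element has an OA-factorization. -/
def IsCOAFL : Prop := ∀ x : L, IsCompactElement x → HasFactorization IsOAElt x

/-- Every principal element has an OA-factorization. -/
def IsPOAFL : Prop := ∀ x : L, IsPrincipalElt x → HasFactorization IsOAElt x

/-- Every element has a TA-factorization. -/
def IsTAFL : Prop := ∀ x : L, HasFactorization IsTAElt x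

/-- Every compact element has a TA-factorization. -/
def IsCTAFL : Prop := ∀ x : L, IsCompactElement x → HasFactorization IsTAElt x

/-- Every principal element has a TA-factorization. -/
def IsPTAFL : Prop := ∀ x : L, IsPrincipalElt x → HasFactorization IsTAElt x

end Lattices

end MultLattice

/-! Elements between `m ^ 2` and `m` are OA-elements, every OA-element is a TA-element, and in
dimension at most one every nonzero TA-element lies between `m ^ 2` and `m`. This drives both
directions.

From TA-factorizations to the powers of `m`: in dimension at most one, a nonzero proper principal
`f` satisfies `m ^ (2 * k) ≤ f ≤ m ^ k` with `k > 0`. If `f` is not below `m ^ 2` then `k = 1`, so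
`m ^ 2` is comparable; if `f` lay below all powers of `m`, then `f ≤ m * f`, which cancellation
forbids. Conversely, choose a principal `e ≤ m` not below `m ^ 2`. Comparability gives `m ^ 2 ≤ m *
e`, so an `x` below `m ^ (n + 1)` but not `m ^ (n + 2)` is `y * e ^ n`, where `y` is `1` or lies
between `m ^ 2` and `m`.

The hard point is that a CTAFL has dimension at most one. `not_lt_of_isCTAFL` shows that a prime `q`
minimal over a compact element has no nonzero prime strictly below it, by working locally at `q`
with Nakayama's lemma (`IsCLattice.le_loc_of_le_loc_sup_mul`). `eq_bot_or_eq_of_isCTAFL` reaches `m`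
itself, using that a TA-element has at most two minimal primes (`IsTAElt.exists_primes`). -/

namespace MultLattice

/-! ### Residuals, primes and cancellation of principal elements -/

section Basic

variable {L : Type*} [CommMonoid L] [CompleteLattice L]

theorem IsPrimeElt.le_of_mul_self_le {p a : L} (hp : IsPrimeElt p) (h : a * a ≤ p) : a ≤ p :=
  (hp.2 _ _ h).elim id id

variable [IsMultiplicativeLattice L]

theorem one_eq_top : (1 : L) = ⊤ := IsMultiplicativeLattice.one_eq_top

theorem top_mul (a : L) : ⊤ * a = a := by rw [← one_eq_top, one_mul]

theorem mul_top (a : L) : a * ⊤ = a := by rw [← one_eq_top, mul_one]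

theorem mul_le_left (a b : L) : a * b ≤ a := by
  simpa [mul_top] using mul_le_mul_right (le_top : b ≤ ⊤) a

theorem mul_le_right (a b : L) : a * b ≤ b := by
  rw [mul_comm]; exact mul_le_left b a

theorem le_residual_iff {x a b : L} : x ≤ residual a b ↔ x * b ≤ a :=
  Quantale.leftMulResiduation_le_iff_mul_le (x := x) (y := b) (z := a)

theorem residual_mul_le (a b : L) : residual a b * b ≤ a := le_residual_iff.1 le_rfl

theorem IsPrimeElt.le_of_pow_le {p a : L} (hp : IsPrimeElt p) {n : ℕ} (h : a ^ n ≤ p) : a ≤ p := by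
  induction n with
  | zero =>
    rw [pow_zero, one_eq_top] at h
    exact le_top.trans h
  | succ n ih =>
    rw [pow_succ] at h
    exact (hp.2 _ _ h).elim ih id

theorem IsPrimeElt.exists_mem_le {p : L} (hp : IsPrimeElt p) (s : Multiset L)
    (h : s.prod ≤ p) : ∃ y ∈ s, y ≤ p := by
  induction s using Multiset.induction with
  | empty =>
    rw [Multiset.prod_zero, one_eq_top] at h
    exact absurd (top_le_iff.1 h) hp.1.ne
  | cons a s ih =>
    rw [Multiset.prod_cons] at h
    rcases hp.2 _ _ h with h | h
    · exact ⟨a, by simp, h⟩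
    · obtain ⟨y, hy, hyp⟩ := ih h
      exact ⟨y, by simp [hy], hyp⟩

theorem prod_le_of_mem {s : Multiset L} {y : L} (h : y ∈ s) : s.prod ≤ y := by
  obtain ⟨t, rfl⟩ := Multiset.exists_cons_of_mem h
  rw [Multiset.prod_cons]
  exact mul_le_left _ _

theorem IsMeetPrincipal.eq_residual_mul {e a : L} (he : IsMeetPrincipal e) (h : a ≤ e) :
    a = residual a e * e := by
  have := he a ⊤
  rwa [top_mul, inf_eq_left.2 h, inf_top_eq] at this

theorem residual_bot (hdom : IsLatticeDomain L) {e : L} (h0 : e ≠ ⊥) : residual ⊥ e = ⊥ := by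
  have := residual_mul_le ⊥ e
  rcases hdom.2 _ _ this with h | h
  · exact le_bot_iff.1 h
  · exact absurd (le_bot_iff.1 h) h0

/-- In a domain `(0 : e) = 0`, so join-principality at `a = 0` reads `(be : e) = b`. -/
theorem IsJoinPrincipal.le_of_mul_le_mul (hdom : IsLatticeDomain L) {e a b : L}
    (he : IsJoinPrincipal e) (h0 : e ≠ ⊥) (h : a * e ≤ b * e) : a ≤ b := by
  have := he ⊥ b
  rw [residual_bot hdom h0, bot_sup_eq, bot_sup_eq] at this
  rw [← this]
  exact le_residual_iff.2 h

theorem IsJoinPrincipal.le_of_mul_pow_le_mul_pow (hdom : IsLatticeDomain L) {e a b : L}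
    (he : IsJoinPrincipal e) (h0 : e ≠ ⊥) (n : ℕ) (h : a * e ^ n ≤ b * e ^ n) : a ≤ b := by
  induction n with
  | zero => simpa using h
  | succ n ih =>
    rw [pow_succ, ← mul_assoc, ← mul_assoc] at h
    exact ih (he.le_of_mul_le_mul hdom h0 h)

theorem IsPrincipalElt.exists_eq_mul_pow (hdom : IsLatticeDomain L) {e : L}
    (he : IsPrincipalElt e) (h0 : e ≠ ⊥) {n : ℕ} {a : L} (h : a ≤ e ^ n) :
    ∃ b, a = b * e ^ n := by
  induction n generalizing a with
  | zero => exact ⟨a, by simp⟩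
  | succ n ih =>
    obtain ⟨b, rfl⟩ := ih (h.trans (by rw [pow_succ]; exact mul_le_left _ _))
    rw [pow_succ'] at h
    have hb := he.1.eq_residual_mul (he.2.le_of_mul_pow_le_mul_pow hdom h0 n h)
    refine ⟨residual b e, ?_⟩
    conv_lhs => rw [hb]
    rw [pow_succ', mul_assoc]

end Basic

/-! ### Compact elements in C-lattices -/

section Compact

variable {L : Type*} [CompleteLattice L]

theorem isCompactElement_sup {a b : L} (ha : IsCompactElement a) (hb : IsCompactElement b) :
    IsCompactElement (a ⊔ b) := by
  classical
  have := CompleteLattice.isCompactElement_finsetSup ({a, b} : Finset L) (f := id)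
    (by simp [ha, hb])
  simpa using this

theorem exists_finset_of_isCompactElement {P : L → Prop} {c : L} (hc : IsCompactElement c)
    (hgen : ∃ S : Set L, (∀ e ∈ S, P e) ∧ sSup S = c) :
    ∃ t : Finset L, (∀ e ∈ t, P e) ∧ t.sup id = c := by
  obtain ⟨S, hS, rfl⟩ := hgen
  rw [CompleteLattice.isCompactElement_iff_exists_le_sSup_of_le_sSup] at hc
  obtain ⟨t, htS, ht⟩ := hc S le_rfl
  refine ⟨t, fun e he => hS e (htS he), le_antisymm ?_ ht⟩
  exact Finset.sup_le fun e he => le_sSup (htS he)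

theorem exists_not_le {P : L → Prop} {a b : L}
    (hgen : ∃ S : Set L, (∀ e ∈ S, P e) ∧ sSup S = a) (h : ¬ a ≤ b) :
    ∃ e, P e ∧ e ≤ a ∧ ¬ e ≤ b := by
  obtain ⟨S, hS, rfl⟩ := hgen
  by_contra! hcon
  exact h (sSup_le fun e he => hcon e (hS e he) (le_sSup he))

variable [CommMonoid L]

theorem IsCLattice.isCompactlyGenerated (hC : IsCLattice L) : IsCompactlyGenerated L := by
  obtain ⟨C, hC1, hC2⟩ := hC
  refine ⟨fun x => ?_⟩
  obtain ⟨S, hS, h⟩ := hC2 x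
  exact ⟨S, fun c hc => hC1 c (hS hc), h⟩

theorem IsCLattice.isCompactElement_one (hC : IsCLattice L) : IsCompactElement (1 : L) := by
  obtain ⟨C, hC1, -⟩ := hC
  exact hC1 _ C.one_mem

variable [IsMultiplicativeLattice L]

theorem isCompactElement_finset_sup_mul {t : Finset L} {d : L}
    (h : ∀ e ∈ t, IsCompactElement (e * d)) : IsCompactElement (t.sup id * d) := by
  have : t.sup id * d = t.sup (fun e => e * d) :=
    Finset.apply_sup_eq_sup_comp (fun x => x * d) (fun _ _ => Quantale.sup_mul_distrib)
      Quantale.bot_mul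
  rw [this]
  exact CompleteLattice.isCompactElement_finsetSup t h

theorem IsCLattice.isCompactElement_mul (hC : IsCLattice L) {a b : L} (ha : IsCompactElement a)
    (hb : IsCompactElement b) : IsCompactElement (a * b) := by
  obtain ⟨C, hC1, hC2⟩ := hC
  obtain ⟨t, ht, rfl⟩ := exists_finset_of_isCompactElement (P := (· ∈ C)) ha (hC2 a)
  obtain ⟨t', ht', rfl⟩ := exists_finset_of_isCompactElement (P := (· ∈ C)) hb (hC2 b)
  refine isCompactElement_finset_sup_mul fun e he => ?_
  rw [mul_comm]
  refine isCompactElement_finset_sup_mul fun e' he' => ?_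
  exact hC1 _ (C.mul_mem (ht' e' he') (ht e he))

theorem IsCLattice.isCompactElement_pow (hC : IsCLattice L) {a : L} (ha : IsCompactElement a)
    (n : ℕ) : IsCompactElement (a ^ n) := by
  induction n with
  | zero => rw [pow_zero]; exact hC.isCompactElement_one
  | succ n ih => rw [pow_succ]; exact hC.isCompactElement_mul ih ha

/-- If `e ≤ sSup D` with `D` directed, upper continuity and meet-principality give `e = w * e`,
where `w` is the join of the residuals `(d : e)`. Join-principality then forces `w = ⊤`, and
compactness of `1` makes a single `(d : e)` equal to `⊤`. -/
theorem IsCLattice.isCompactElement_of_isPrincipalElt (hC : IsCLattice L) {e : L}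
    (he : IsPrincipalElt e) : IsCompactElement e := by
  have := hC.isCompactlyGenerated
  rw [CompleteLattice.isCompactElement_iff_le_of_directed_sSup_le]
  intro D hD hdir hle
  have h1 : e = sSup ((fun d => residual d e) '' D) * e := by
    conv_lhs => rw [← inf_eq_left.2 hle, DirectedOn.inf_sSup_eq hdir]
    rw [sSup_mul_distrib, iSup_image]
    refine iSup_congr fun d => iSup_congr fun _ => ?_
    have := he.1 d ⊤
    rwa [top_mul, inf_top_eq, inf_comm] at this
  set w := sSup ((fun d => residual d e) '' D) with hw
  have h2 : residual ⊥ e ⊔ w = ⊤ := by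
    rw [← he.2 ⊥ w, ← h1, bot_sup_eq, ← top_le_iff, le_residual_iff, top_mul]
  have h3 : residual ⊥ e ≤ w := by
    obtain ⟨d, hd⟩ := hD
    refine le_trans ?_ (le_sSup (Set.mem_image_of_mem _ hd))
    exact le_residual_iff.2 ((residual_mul_le _ _).trans bot_le)
  rw [sup_eq_right.2 h3] at h2
  have h4 := hC.isCompactElement_one
  rw [one_eq_top, CompleteLattice.isCompactElement_iff_le_of_directed_sSup_le] at h4
  obtain ⟨x, ⟨d, hd, rfl⟩, hx⟩ := h4 ((fun d => residual d e) '' D) (hD.image _)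
    (by
      rintro _ ⟨a, ha, rfl⟩ _ ⟨b, hb, rfl⟩
      obtain ⟨c, hc, hac, hbc⟩ := hdir a ha b hb
      exact ⟨_, ⟨c, hc, rfl⟩, le_residual_iff.2 ((residual_mul_le _ _).trans hac),
        le_residual_iff.2 ((residual_mul_le _ _).trans hbc)⟩) h2.ge
  refine ⟨d, hd, ?_⟩
  have := le_residual_iff.1 hx
  rwa [top_mul] at this

end Compact

/-! ### Structure of 2-absorbing elements -/

section TwoAbsorbing

theorem HasFactorization.mono {L : Type*} [CommMonoid L] {P Q : L → Prop}
    (hPQ : ∀ y, P y → Q y) {x : L}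
    (h : HasFactorization P x) : HasFactorization Q x := by
  obtain ⟨s, hs, h⟩ := h
  exact ⟨s, fun y hy => hPQ y (hs y hy), h⟩

variable {L : Type*} [CommMonoid L] [CompleteLattice L]

theorem IsTAElt.mul_self_le_of_cube_le {y a : L} (hy : IsTAElt y) (h : a * a * a ≤ y) :
    a * a ≤ y := by
  rcases hy.2 a a a h with h | h | h <;> exact h

theorem IsOAElt.isTAElt [IsMultiplicativeLattice L] {x : L} (hx : IsOAElt x) : IsTAElt x := by
  refine ⟨hx.1, fun a b c h => ?_⟩
  by_cases ha : a = ⊤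
  · subst ha; rw [top_mul] at h; exact .inr (.inr h)
  by_cases hb : b = ⊤
  · subst hb; rw [mul_top] at h; exact .inr (.inl h)
  by_cases hc : c = ⊤
  · subst hc; rw [mul_top] at h; exact .inl h
  rcases hx.2 a b c ha hb hc h with h | h
  · exact .inl h
  · exact .inr (.inl ((mul_le_right a c).trans h))

variable [IsMultiplicativeLattice L]

/-- Every prime above a 2-absorbing element `y` contains one of two primes `P`, `Q` above `y`,
and a semiprime `r` with `P * Q ≤ r ≤ P ⊓ Q` satisfies `y ≤ r` and `r * r ≤ y`. -/
theorem IsTAElt.exists_primes {y : L} (hy : IsTAElt y) :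
    ∃ r P Q : L, IsPrimeElt P ∧ IsPrimeElt Q ∧ y ≤ r ∧ r * r ≤ y ∧
      (∀ z, z * z ≤ r → z ≤ r) ∧ r ≤ P ∧ r ≤ Q ∧ P * Q ≤ r := by
  set r := sSup {z | z * z ≤ y} with hr
  have hpair : ∀ u v : L, u * u ≤ y → v * v ≤ y → u * v ≤ y := by
    intro u v hu hv
    -- Every cubic monomial in `u` and `v` contains `u * u` or `v * v`.
    have h1 : (u ⊔ v) * (u ⊔ v) * (u ⊔ v) ≤ y := by
      simp only [Quantale.sup_mul_distrib, Quantale.mul_sup_distrib, sup_le_iff]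
      have e1 : u * v * u = u * u * v := by rw [mul_assoc, mul_comm v, mul_assoc]
      have e2 : v * u * v = v * v * u := by rw [mul_assoc, mul_comm u, mul_assoc]
      have e3 : v * u * u = u * u * v := by rw [mul_comm, mul_comm v, mul_assoc]
      have e4 : u * v * v = v * v * u := by rw [mul_comm, mul_comm u, mul_assoc]
      have h1 := fun x => (mul_le_left (u * u) x).trans hu
      have h2 := fun x => (mul_le_left (v * v) x).trans hv
      simp only [e1, e2, e3, e4, h1, h2, and_self]
    exact (mul_le_mul' le_sup_left le_sup_right).trans (hy.mul_self_le_of_cube_le h1)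
  have hrr : r * r ≤ y := by
    rw [hr, sSup_mul_distrib]
    refine iSup₂_le fun u hu => ?_
    rw [mul_sSup_distrib]
    exact iSup₂_le fun v hv => hpair u v hu hv
  have hle : ∀ z, z ≤ r ↔ z * z ≤ y := fun z =>
    ⟨fun h => (mul_le_mul' h h).trans hrr, fun h => le_sSup h⟩
  have hyr : y ≤ r := (hle y).2 (mul_le_left _ _)
  have hsemi : ∀ z, z * z ≤ r → z ≤ r := by
    intro z hz
    rw [hle] at hz ⊢
    rcases hy.2 _ _ _ hz with h | h | h
    · exact h
    all_goals exact hy.mul_self_le_of_cube_le (by rwa [mul_assoc])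
  have hTA : ∀ a b c, a * b * c ≤ r → a * b ≤ r ∨ a * c ≤ r ∨ b * c ≤ r := by
    intro a b c h
    simp only [hle] at h ⊢
    have : (a * a) * (b * b) * (c * c) ≤ y := by
      convert h using 1; ac_rfl
    rcases hy.2 _ _ _ this with h | h | h
    · left; convert h using 1; ac_rfl
    · right; left; convert h using 1; ac_rfl
    · right; right; convert h using 1; ac_rfl
  have hrtop : r < ⊤ := by
    rw [lt_top_iff_ne_top]
    intro h
    have := (hle ⊤).1 h.ge
    rw [top_mul] at this
    exact hy.1.not_ge this
  by_cases hp : IsPrimeElt r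
  · exact ⟨r, r, r, hp, hp, hyr, hrr, hsemi, le_rfl, le_rfl, mul_le_left _ _⟩
  have hex : ∃ a b, a * b ≤ r ∧ ¬ a ≤ r ∧ ¬ b ≤ r := by
    by_contra! hcon
    exact hp ⟨hrtop, fun a b h => or_iff_not_imp_left.2 (hcon a b h)⟩
  have hprime : ∀ a b, a * b ≤ r → ¬ a ≤ r → ¬ b ≤ r → IsPrimeElt (residual r a) := by
    intro a b hab ha hb
    refine ⟨?_, fun u v huv => ?_⟩
    · rw [lt_top_iff_ne_top]
      intro h
      have := le_residual_iff.1 h.ge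
      rw [top_mul] at this
      exact ha this
    rw [le_residual_iff] at huv
    rw [le_residual_iff, le_residual_iff]
    -- Adding `b` to both factors excludes the unwanted alternative: it would give `b * b ≤ r`,
    -- hence `b ≤ r`.
    have h1 : (u ⊔ b) * (v ⊔ b) * a ≤ r := by
      simp only [Quantale.sup_mul_distrib, Quantale.mul_sup_distrib, sup_le_iff]
      have hb' : b * a ≤ r := by rwa [mul_comm]
      refine ⟨⟨huv, ?_⟩, ?_, ?_⟩
      · rw [mul_comm b v, mul_assoc]; exact (mul_le_right _ _).trans hb'
      · rw [mul_assoc]; exact (mul_le_right _ _).trans hb'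
      · rw [mul_assoc]; exact (mul_le_right _ _).trans hb'
    rcases hTA _ _ _ h1 with h | h | h
    · exact absurd (hsemi b ((mul_le_mul' le_sup_right le_sup_right).trans h)) hb
    · exact .inl ((mul_le_mul' le_sup_left le_rfl).trans h)
    · exact .inr ((mul_le_mul' le_sup_left le_rfl).trans h)
  obtain ⟨a, b, hab, ha, hb⟩ := hex
  have hba : b * a ≤ r := by rwa [mul_comm]
  refine ⟨r, residual r a, residual r b, hprime a b hab ha hb, hprime b a hba hb ha, hyr, hrr,
    hsemi, le_residual_iff.2 (mul_le_left _ _), le_residual_iff.2 (mul_le_left _ _), ?_⟩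
  set u := residual r a with hu
  set v := residual r b with hv
  have hua : u * a ≤ r := residual_mul_le _ _
  have hvb : v * b ≤ r := residual_mul_le _ _
  -- Same device: the alternatives other than `u * v ≤ r` would put `b * b` or `a * a` below `r`.
  have h1 : (u ⊔ b) * (v ⊔ a) * (a ⊔ b) ≤ r := by
    have h2 : (u ⊔ b) * a ≤ r := by
      rw [Quantale.sup_mul_distrib]; exact sup_le hua hba
    have h3 : (v ⊔ a) * b ≤ r := by
      rw [Quantale.sup_mul_distrib]; exact sup_le hvb hab
    rw [Quantale.mul_sup_distrib]
    refine sup_le ?_ ?_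
    · rw [mul_comm (u ⊔ b), mul_assoc]; exact (mul_le_right _ _).trans h2
    · rw [mul_assoc]; exact (mul_le_right _ _).trans h3
  rcases hTA _ _ _ h1 with h | h | h
  · exact (mul_le_mul' le_sup_left le_sup_left).trans h
  · exact absurd (hsemi b ((mul_le_mul' le_sup_right le_sup_right).trans h)) hb
  · exact absurd (hsemi a ((mul_le_mul' le_sup_right le_sup_left).trans h)) ha

end TwoAbsorbing

/-! ### Localization at a prime, Nakayama's lemma and local bounds on products -/

section Localization

variable {L : Type*} [CommMonoid L] [CompleteLattice L]

/-- The localization of `b` at a prime element `q`, seen as an element of `L`. -/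
def loc (q b : L) : L := sSup {u | ∃ s, ¬ s ≤ q ∧ s * u ≤ b}

theorem le_loc_of {q b s u : L} (hs : ¬ s ≤ q) (h : s * u ≤ b) : u ≤ loc q b :=
  le_sSup ⟨s, hs, h⟩

theorem loc_mono (q : L) {a b : L} (h : a ≤ b) : loc q a ≤ loc q b :=
  sSup_le_sSup fun _ ⟨s, hs, hu⟩ => ⟨s, hs, hu.trans h⟩

theorem IsCLattice.exists_compact_not_le (hC : IsCLattice L) {a b : L} (h : ¬ a ≤ b) :
    ∃ c, IsCompactElement c ∧ c ≤ a ∧ ¬ c ≤ b :=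
  have := hC.isCompactlyGenerated
  exists_not_le (IsCompactlyGenerated.exists_sSup_eq a) h

variable [IsMultiplicativeLattice L] {q : L}

theorem le_loc (hq : IsPrimeElt q) (b : L) : b ≤ loc q b :=
  le_loc_of hq.1.not_ge (top_mul b).le

theorem loc_mul_loc_le (hq : IsPrimeElt q) (a b : L) : loc q a * loc q b ≤ loc q (a * b) := by
  rw [loc, sSup_mul_distrib]
  refine iSup₂_le fun u ⟨s, hs, hu⟩ => ?_
  rw [loc, mul_sSup_distrib]
  refine iSup₂_le fun v ⟨t, ht, hv⟩ => ?_
  refine le_loc_of (s := s * t) (fun h => (hq.2 _ _ h).elim hs ht) ?_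
  rw [mul_mul_mul_comm]
  exact mul_le_mul' hu hv

theorem loc_of_isPrimeElt (hq : IsPrimeElt q) {P : L} (hP : IsPrimeElt P) (h : P ≤ q) :
    loc q P = P := by
  refine le_antisymm (sSup_le fun u ⟨s, hs, hu⟩ => ?_) (le_loc hq P)
  exact (hP.2 _ _ hu).resolve_left fun h' => hs (h'.trans h)

/-- The set whose join defines `loc q b` is directed, since denominators multiply; compactness then
selects one denominator. -/
theorem exists_mul_le_of_le_loc (hq : IsPrimeElt q) {c b : L} (hc : IsCompactElement c)
    (h : c ≤ loc q b) : ∃ s, ¬ s ≤ q ∧ s * c ≤ b := by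
  rw [CompleteLattice.isCompactElement_iff_le_of_directed_sSup_le] at hc
  obtain ⟨u, ⟨s, hs, hu⟩, hcu⟩ := hc {u | ∃ s, ¬ s ≤ q ∧ s * u ≤ b}
    ⟨b, ⊤, hq.1.not_ge, (top_mul b).le⟩ (by
    rintro u ⟨s, hs, hu⟩ v ⟨t, ht, hv⟩
    refine ⟨u ⊔ v, ⟨s * t, fun h => (hq.2 _ _ h).elim hs ht, ?_⟩, le_sup_left, le_sup_right⟩
    rw [Quantale.mul_sup_distrib]
    refine sup_le ?_ ?_
    · rw [mul_comm s, mul_assoc]; exact (mul_le_right _ _).trans hu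
    · rw [mul_assoc]; exact (mul_le_right _ _).trans hv) h
  exact ⟨s, hs, (mul_le_mul' le_rfl hcu).trans hu⟩

theorem IsCLattice.loc_le_loc_of_le (hC : IsCLattice L) (hq : IsPrimeElt q) {a b : L}
    (h : a ≤ loc q b) : loc q a ≤ loc q b := by
  have := hC.isCompactlyGenerated
  refine sSup_le fun u ⟨s, hs, hu⟩ => ?_
  rw [le_iff_compact_le_imp]
  intro c hc hcu
  -- A compact denominator keeps `t * c` compact.
  obtain ⟨t, ht, hts, htq⟩ := hC.exists_compact_not_le hs
  obtain ⟨w, hw, hwb⟩ := exists_mul_le_of_le_loc hq (hC.isCompactElement_mul ht hc)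
    ((mul_le_mul' hts hcu).trans (hu.trans h))
  refine le_loc_of (s := w * t) (fun h => (hq.2 _ _ h).elim hw htq) ?_
  rwa [mul_assoc]

/-- Nakayama's lemma at `q`, by eliminating the principal generators of `c` one at a time. -/
theorem IsCLattice.le_loc_of_le_loc_sup_mul (hC : IsCLattice L) (hpg : IsPrincipallyGenerated L)
    (hq : IsPrimeElt q) {a c : L} (hc : IsCompactElement c) (h : c ≤ loc q (a ⊔ c * q)) :
    c ≤ loc q a := by
  classical
  obtain ⟨t, ht, rfl⟩ := exists_finset_of_isCompactElement hc (hpg c)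
  clear hc
  induction t using Finset.induction generalizing a with
  | empty => simp
  | insert e t _ ih =>
    rw [Finset.sup_insert, id] at h ⊢
    have he := ht e (by simp)
    set d := t.sup id with hd
    have h1 : e ≤ loc q (a ⊔ d * q) := by
      obtain ⟨s, hs, hle⟩ := exists_mul_le_of_le_loc hq
        (hC.isCompactElement_of_isPrincipalElt he) (le_sup_left.trans h)
      rw [← le_residual_iff] at hle
      rw [Quantale.sup_mul_distrib, sup_comm (e * q), ← sup_assoc, mul_comm e, he.2] at hle
      -- Join-principality turned `hle` into `s ≤ (a ⊔ d * q : e) ⊔ q`; as `s` is not below `q`,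
      -- neither is this residual, which thus serves as denominator.
      refine le_loc_of (s := residual (a ⊔ d * q) e) (fun h' => hs (hle.trans ?_))
        (residual_mul_le _ _)
      exact sup_le h' le_rfl
    have h2 : d ≤ loc q (a ⊔ d * q) := by
      refine le_sup_right.trans (h.trans (hC.loc_le_loc_of_le hq ?_))
      rw [Quantale.sup_mul_distrib]
      refine sup_le (le_sup_left.trans (le_loc hq _)) (sup_le ?_ ?_)
      · exact (mul_le_left _ _).trans h1
      · exact le_sup_right.trans (le_loc hq _)
    have h3 : d ≤ loc q a := ih (fun e he => ht e (by simp [he])) h2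
    refine sup_le (h1.trans (hC.loc_le_loc_of_le hq ?_)) h3
    exact sup_le (le_loc hq a) ((mul_le_left _ _).trans h3)

/-- One of the two primes over `y` equals `q` by minimality. The other equals `q` too, or is not
below `q` and acts as a denominator; either way `q` is locally below the radical `r`, and `r * r ≤
y`. -/
theorem IsTAElt.mul_self_le_loc (hq : IsPrimeElt q) {y : L} (hy : IsTAElt y) (hyq : y ≤ q)
    (hmin : ∀ P, IsPrimeElt P → y ≤ P → P ≤ q → P = q) : q * q ≤ loc q y := by
  obtain ⟨r, P, Q, hP, hQ, hyr, hrr, hsemi, hrP, hrQ, hPQ⟩ := hy.exists_primes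
  have hrq : r ≤ q := hq.le_of_mul_self_le (hrr.trans hyq)
  have key : q ≤ loc q r := by
    have aux : ∀ P Q : L, IsPrimeElt P → IsPrimeElt Q → r ≤ P → r ≤ Q → P * Q ≤ r → P ≤ q →
        q ≤ loc q r := by
      intro P Q hP hQ hrP hrQ hPQ hPq
      obtain rfl := hmin P hP (hyr.trans hrP) hPq
      by_cases hQq : Q ≤ P
      · obtain rfl := hmin Q hQ (hyr.trans hrQ) hQq
        exact (hsemi _ hPQ).trans (le_loc hq r)
      · exact le_loc_of hQq (by rwa [mul_comm])
    rcases hq.2 _ _ (hPQ.trans hrq) with h | h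
    · exact aux P Q hP hQ hrP hrQ hPQ h
    · exact aux Q P hQ hP hrQ hrP (by rwa [mul_comm]) h
  exact (mul_le_mul' key key).trans ((loc_mul_loc_le hq _ _).trans (loc_mono q hrr))

/-- Here `k` counts the factors below `q`; the others become `⊤` locally. -/
theorem exists_pow_le_loc_prod (hq : IsPrimeElt q) (s : Multiset L)
    (hs : ∀ y ∈ s, y ≤ q → q * q ≤ loc q y) :
    ∃ k, q ^ (2 * k) ≤ loc q s.prod ∧ s.prod ≤ q ^ k ∧ (k = 0 → ¬ s.prod ≤ q) := by
  induction s using Multiset.induction with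
  | empty =>
    refine ⟨0, ?_, ?_, fun _ => ?_⟩
    · simpa using le_loc hq 1
    · simp
    · rw [Multiset.prod_zero, one_eq_top]; exact hq.1.not_ge
  | cons y s ih =>
    obtain ⟨k, h1, h2, h3⟩ := ih fun z hz => hs z (by simp [hz])
    rw [Multiset.prod_cons]
    by_cases hy : y ≤ q
    · refine ⟨k + 1, ?_, ?_, by simp⟩
      · rw [mul_add, mul_one, pow_add, mul_comm, pow_two]
        exact (mul_le_mul' (hs y (by simp) hy) h1).trans (loc_mul_loc_le hq _ _)
      · rw [pow_succ']; exact mul_le_mul' hy h2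
    · refine ⟨k, ?_, (mul_le_right _ _).trans h2, fun hk h => ?_⟩
      · refine h1.trans ?_
        have : (⊤ : L) ≤ loc q y := le_loc_of hy (mul_top y).le
        calc loc q s.prod = ⊤ * loc q s.prod := (top_mul _).symm
          _ ≤ loc q y * loc q s.prod := mul_le_mul' this le_rfl
          _ ≤ _ := loc_mul_loc_le hq _ _
      · exact (hq.2 _ _ h).elim hy (h3 hk)

/-- If `q` is a minimal prime of a product `z` of 2-absorbing elements, then
`q ^ (2 * k) ≤ z ≤ q ^ k` locally at `q` for some positive `k`. -/
theorem HasFactorization.exists_pow_le_loc (hq : IsPrimeElt q) {z : L}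
    (hz : HasFactorization IsTAElt z) (hzq : z ≤ q)
    (hmin : ∀ P, IsPrimeElt P → z ≤ P → P ≤ q → P = q) :
    ∃ k, 0 < k ∧ q ^ (2 * k) ≤ loc q z ∧ z ≤ q ^ k := by
  obtain ⟨s, hs, rfl⟩ := hz
  obtain ⟨k, h1, h2, h3⟩ := exists_pow_le_loc_prod hq s fun y hy hyq =>
    (hs y hy).mul_self_le_loc hq hyq fun P hP hyP => hmin P hP ((prod_le_of_mem hy).trans hyP)
  exact ⟨k, Nat.pos_of_ne_zero fun h => h3 h hzq, h1, h2⟩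

end Localization

/-! ### A CTAFL has dimension at most one -/

section Dimension

variable {L : Type*} [CommMonoid L] [CompleteLattice L] [IsMultiplicativeLattice L]

/-- Below a nonzero prime element there is a nonzero 2-absorbing element which is compact and
cancellative, namely a factor of a principal element. -/
theorem exists_isTAElt_le (hC : IsCLattice L) (hpg : IsPrincipallyGenerated L)
    (hdom : IsLatticeDomain L) (hCTA : IsCTAFL L) {p : L} (hp : IsPrimeElt p) (hp0 : p ≠ ⊥) :
    ∃ f, IsTAElt f ∧ f ≤ p ∧ f ≠ ⊥ ∧ IsCompactElement f ∧
      ∀ a b, a * f ≤ b * f → a ≤ b := by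
  obtain ⟨e, he, hep, he0⟩ := exists_not_le (hpg p) (fun h => hp0 (le_bot_iff.1 h))
  replace he0 : e ≠ ⊥ := fun h => he0 h.le
  have hec := hC.isCompactElement_of_isPrincipalElt he
  obtain ⟨s, hs, rfl⟩ := hCTA e hec
  obtain ⟨f, hf, hfp⟩ := hp.exists_mem_le s hep
  obtain ⟨t, rfl⟩ := Multiset.exists_cons_of_mem hf
  rw [Multiset.prod_cons] at he he0 hec
  set h := t.prod
  have hcancel : ∀ a b, a * f ≤ b * f → a ≤ b := fun a b hab =>
    he.2.le_of_mul_le_mul hdom he0 (by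
      rw [← mul_assoc, ← mul_assoc]; exact mul_le_mul' hab le_rfl)
  have hcancel' : ∀ a b, a * h ≤ b * h → a ≤ b := fun a b hab =>
    he.2.le_of_mul_le_mul hdom he0 (by
      rw [mul_comm f, ← mul_assoc, ← mul_assoc]; exact mul_le_mul' hab le_rfl)
  refine ⟨f, hs f hf, hfp, ?_, ?_, hcancel⟩
  · rintro rfl
    exact he0 Quantale.bot_mul
  · rw [CompleteLattice.isCompactElement_iff_le_of_directed_sSup_le] at hec ⊢
    -- Compactness passes from `f * h` to its factor `f`: multiply the directed set by `h`, then
    -- cancel `h`.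
    intro D hD hdir hle
    obtain ⟨_, ⟨d, hd, rfl⟩, hfd⟩ := hec ((· * h) '' D) (hD.image _) (by
      rintro _ ⟨a, ha, rfl⟩ _ ⟨b, hb, rfl⟩
      obtain ⟨c, hc, hac, hbc⟩ := hdir a ha b hb
      exact ⟨_, ⟨c, hc, rfl⟩, mul_le_mul' hac le_rfl, mul_le_mul' hbc le_rfl⟩) (by
      rw [sSup_image, ← sSup_mul_distrib]; exact mul_le_mul' hle le_rfl)
    exact ⟨d, hd, hcancel' _ _ hfd⟩

/-- A prime element that is minimal over a compact element has height at most one. -/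
theorem not_lt_of_isCTAFL (hC : IsCLattice L) (hpg : IsPrincipallyGenerated L)
    (hdom : IsLatticeDomain L) (hCTA : IsCTAFL L) {p q c : L} (hp : IsPrimeElt p)
    (hq : IsPrimeElt q) (hp0 : p ≠ ⊥) (hc : IsCompactElement c) (hcq : c ≤ q)
    (hmin : ∀ P, IsPrimeElt P → c ≤ P → P ≤ q → P = q) : ¬ p < q := by
  intro hpq
  obtain ⟨f, hf, hfp, hf0, hfc, hcancel⟩ := exists_isTAElt_le hC hpg hdom hCTA hp hp0
  have hfq : f ≤ q := hfp.trans hpq.le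
  -- By Nakayama `c ^ i ≤ loc q P = P`, so `c ≤ P` and minimality of `q` applies.
  have hNak : ∀ P, IsPrimeElt P → P ≤ q → ∀ i n, i < n → c ^ i ≤ loc q (P ⊔ c ^ n) → P = q := by
    intro P hP hPq i n hin h
    refine hmin P hP (hP.le_of_pow_le (n := i) ?_) hPq
    rw [← loc_of_isPrimeElt hq hP hPq]
    refine hC.le_loc_of_le_loc_sup_mul hpg hq (hC.isCompactElement_pow hc i)
      (h.trans (loc_mono q (sup_le_sup le_rfl ?_)))
    obtain ⟨j, rfl⟩ := Nat.exists_eq_add_of_lt hin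
    rw [add_assoc, pow_add, pow_succ]
    exact mul_le_mul' le_rfl ((mul_le_right _ _).trans hcq)
  have hfac : ∀ z, IsCompactElement z → z ≤ q → (∀ P, IsPrimeElt P → z ≤ P → P ≤ q → P = q) →
      ∃ k, 0 < k ∧ q ^ (2 * k) ≤ loc q z ∧ z ≤ q ^ k := fun z hz =>
    (hCTA z hz).exists_pow_le_loc hq
  -- Factor `f ⊔ c ^ n`: were `2 * k < n`, `hNak` would give `p = q`. Hence `k` is unbounded and `f`
  -- lies below every power of `q`.
  have hfn : ∀ n, 0 < n → ∃ k, n ≤ 2 * k ∧ q ^ (2 * k) ≤ loc q (p ⊔ c ^ n) ∧ f ≤ q ^ k := by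
    intro n hn
    have hcn : c ^ n ≤ q := (pow_le_pow_left' hcq n).trans (by
      obtain ⟨j, rfl⟩ := Nat.exists_eq_succ_of_ne_zero hn.ne'
      rw [pow_succ]; exact mul_le_right _ _)
    obtain ⟨k, -, h1, h2⟩ := hfac (f ⊔ c ^ n)
      (isCompactElement_sup hfc (hC.isCompactElement_pow hc n)) (sup_le hfq hcn)
      fun P hP h => hmin P hP (hP.le_of_pow_le (le_sup_right.trans h))
    have h3 := h1.trans (loc_mono q (sup_le_sup hfp le_rfl))
    refine ⟨k, ?_, h3, le_sup_left.trans h2⟩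
    by_contra! hlt
    exact hpq.ne (hNak p hp hpq.le _ _ hlt ((pow_le_pow_left' hcq _).trans h3))
  have hfpow : ∀ j, f ≤ q ^ j := by
    intro j
    obtain ⟨k, hk, -, h⟩ := hfn (2 * j + 1) (by omega)
    refine h.trans ?_
    obtain ⟨i, rfl⟩ := Nat.exists_eq_add_of_le (show j ≤ k by omega)
    rw [pow_add]; exact mul_le_left _ _
  have hqq : ¬ q ≤ loc q (q * q) := by
    intro h
    have hall : ∀ n, q ≤ loc q (q ^ (n + 1)) := by
      intro n
      induction n with
      | zero => simpa using le_loc hq q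
      | succ n ih =>
        refine h.trans (hC.loc_le_loc_of_le hq ?_)
        rw [pow_succ]
        exact (mul_le_mul' ih (le_loc hq q)).trans (loc_mul_loc_le hq _ _)
    obtain ⟨k, hk, h1, -⟩ := hfn 2 (by norm_num)
    refine hpq.ne (hNak p hp hpq.le 1 2 (by norm_num) ?_)
    rw [pow_one]
    obtain ⟨i, hi⟩ := Nat.exists_eq_add_of_le (show 1 ≤ 2 * k by omega)
    rw [hi, add_comm] at h1
    exact hcq.trans ((hall i).trans (hC.loc_le_loc_of_le hq h1))
  obtain ⟨e, he, heq, heqq⟩ := exists_not_le (hpg q) hqq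
  have hec := hC.isCompactElement_of_isPrincipalElt he
  have he0 : e ≠ ⊥ := by rintro rfl; exact heqq bot_le
  -- Since `e` is not locally below `q * q`, the exponent `k` for `e ⊔ d` must be `1`.
  have hed : ∀ d, IsCompactElement d → d ≤ q →
      (∀ P, IsPrimeElt P → e ⊔ d ≤ P → P ≤ q → P = q) → q * q ≤ loc q (e ⊔ d) := by
    intro d hd hdq hm
    obtain ⟨k, hk, h1, h2⟩ := hfac (e ⊔ d) (isCompactElement_sup hec hd) (sup_le heq hdq) hm
    have hk1 : k = 1 := by
      by_contra hne
      obtain ⟨i, rfl⟩ := Nat.exists_eq_add_of_le (show 2 ≤ k by omega)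
      rw [pow_add, pow_two] at h2
      exact heqq (le_sup_left.trans (h2.trans ((mul_le_left _ _).trans (le_loc hq _))))
    subst hk1
    rwa [mul_one, pow_two] at h1
  have hc3 : c ^ 3 ≤ q := by
    rw [pow_succ]; exact (mul_le_right _ _).trans hcq
  -- The cube is what makes `hNak` apply: `c ^ 2 ≤ q * q ≤ loc q (P ⊔ c ^ 3)`.
  have hmin_ef : ∀ P, IsPrimeElt P → e ≤ P → f ≤ P → P ≤ q → P = q := by
    intro P hP heP hfP hPq
    have h1 := hed (f ⊔ c ^ 3) (isCompactElement_sup hfc (hC.isCompactElement_pow hc 3))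
      (sup_le hfq hc3) fun P hP h =>
        hmin P hP (hP.le_of_pow_le (le_sup_right.trans (le_sup_right.trans h)))
    refine hNak P hP hPq 2 3 (by norm_num) ?_
    rw [pow_two, ← sup_assoc] at *
    exact (mul_le_mul' hcq hcq).trans (h1.trans (loc_mono q (sup_le_sup (sup_le heP hfP) le_rfl)))
  have h1 : q * q ≤ loc q (e ⊔ f * f) := hed (f * f) (hC.isCompactElement_mul hfc hfc)
    ((mul_le_left _ _).trans hfq) fun P hP h =>
      hmin_ef P hP (le_sup_left.trans h) (hP.le_of_mul_self_le (le_sup_right.trans h))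
  have hfe : f ≤ loc q e := by
    refine hC.le_loc_of_le_loc_sup_mul hpg hq hfc ?_
    have := hfpow 2
    rw [pow_two] at this
    exact this.trans (h1.trans (loc_mono q (sup_le_sup le_rfl (mul_le_mul' le_rfl hfq))))
  have hqe : q * q ≤ loc q e := by
    refine h1.trans (hC.loc_le_loc_of_le hq (sup_le (le_loc hq e) ?_))
    exact (mul_le_left _ _).trans hfe
  have hf4 : f ≤ loc q (e ^ 2) := by
    have := hfpow (2 + 2)
    rw [pow_add, pow_two] at this
    rw [pow_two]
    exact this.trans ((mul_le_mul' hqe hqe).trans (loc_mul_loc_le hq _ _))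
  -- Now `s * f = g * e * e` with `s` not below `q`, and `f` is 2-absorbing. If `g * e ≤ f`,
  -- cancelling `f` gives `s ≤ e ≤ q`; if `e * e ≤ f ≤ p`, then `p` contains `e` and `f`, so `p =
  -- q`.
  obtain ⟨s, hs, hsf⟩ := exists_mul_le_of_le_loc hq hfc hf4
  obtain ⟨g, hg⟩ := he.exists_eq_mul_pow hdom he0 hsf
  rw [pow_two] at hg
  have hge : g * e * e ≤ f := by
    rw [mul_assoc, ← hg]; exact mul_le_right _ _
  have hge' : g * e ≤ f ∨ e * e ≤ f := by
    rcases hf.2 _ _ _ hge with h | h | h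
    · exact .inl h
    · exact .inl h
    · exact .inr h
  rcases hge' with h | h
  · refine hs ((hcancel s e ?_).trans heq)
    rw [hg, ← mul_assoc, mul_comm e f]
    exact mul_le_mul' h le_rfl
  · exact hpq.ne (hmin_ef p hp (hp.le_of_mul_self_le (h.trans hfp)) hfp hpq.le)

omit [IsMultiplicativeLattice L] in
theorem isPrimeElt_sInf_of_isChain {C : Set L} (hC : ∀ P ∈ C, IsPrimeElt P)
    (hchain : IsChain (· ≤ ·) C) (hne : C.Nonempty) : IsPrimeElt (sInf C) := by
  obtain ⟨y, hy⟩ := hne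
  refine ⟨(sInf_le hy).trans_lt (hC y hy).1, fun a b hab => ?_⟩
  by_contra! hcon
  simp only [le_sInf_iff, not_forall] at hcon
  obtain ⟨⟨P, hP, haP⟩, ⟨Q, hQ, hbQ⟩⟩ := hcon
  have hbP := ((hC P hP).2 a b (hab.trans (sInf_le hP))).resolve_left haP
  have haQ := ((hC Q hQ).2 a b (hab.trans (sInf_le hQ))).resolve_right hbQ
  rcases hchain.total hP hQ with h | h
  · exact hbQ (hbP.trans h)
  · exact haP (haQ.trans h)

omit [IsMultiplicativeLattice L] in
theorem IsPrimeElt.exists_minimal {c q : L} (hq : IsPrimeElt q) (hcq : c ≤ q) :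
    ∃ P, IsPrimeElt P ∧ c ≤ P ∧ P ≤ q ∧ ∀ P', IsPrimeElt P' → c ≤ P' → P' ≤ P → P' = P := by
  have hzorn : ∀ C ⊆ {P : L | IsPrimeElt P ∧ c ≤ P}, IsChain (· ≤ ·) C → ∀ y ∈ C,
      ∃ lb ∈ {P : L | IsPrimeElt P ∧ c ≤ P}, ∀ z ∈ C, lb ≤ z := fun C hCS hchain y hy =>
    ⟨sInf C, ⟨isPrimeElt_sInf_of_isChain (fun P hP => (hCS hP).1) hchain ⟨y, hy⟩,
      le_sInf fun P hP => (hCS hP).2⟩, fun z hz => sInf_le hz⟩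
  obtain ⟨P, hPq, hP⟩ := @zorn_le_nonempty₀ Lᵒᵈ _ {P : L | IsPrimeElt P ∧ c ≤ P}
    (fun C hCS hchain => hzorn C hCS hchain.symm) q ⟨hq, hcq⟩
  exact ⟨P, hP.1.1, hP.1.2, hPq, fun P' hP' hc h => le_antisymm h (hP.2 ⟨hP', hc⟩ h)⟩

/-- A prime `q` minimal over a compact element above `f` contains one of the two primes over `f`,
hence equals it. Adding to `f` compact elements that avoid those primes, unless they are `m`, forces
`q = m`, and then no nonzero prime lies strictly below `m`. -/
theorem eq_bot_or_eq_of_isCTAFL (hC : IsCLattice L) (hpg : IsPrincipallyGenerated L)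
    (hdom : IsLatticeDomain L) (hCTA : IsCTAFL L) {m : L} (hm : IsPrimeElt m)
    (hle : ∀ a : L, a < ⊤ → a ≤ m) {p : L} (hp : IsPrimeElt p) : p = ⊥ ∨ p = m := by
  by_contra! hcon
  obtain ⟨hp0, hpm⟩ := hcon
  have hlt : p < m := lt_of_le_of_ne (hle p hp.1) hpm
  obtain ⟨f, hf, hfp, hf0, hfc, -⟩ := exists_isTAElt_le hC hpg hdom hCTA hp hp0
  obtain ⟨r, P, Q, hP, hQ, hfr, hrr, -, hrP, hrQ, hPQ⟩ := hf.exists_primes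
  have hsep : ∀ P, IsPrimeElt P → ∃ a, IsCompactElement a ∧ a ≤ m ∧ (a ≤ P → P = m) := by
    intro P hP
    by_cases h : m ≤ P
    -- When `P = m` nothing needs avoiding, and `f` is a harmless choice.
    · exact ⟨f, hfc, hfp.trans hlt.le, fun _ => le_antisymm (hle P hP.1) h⟩
    · obtain ⟨a, ha, ham, haP⟩ := hC.exists_compact_not_le h
      exact ⟨a, ha, ham, fun h => absurd h haP⟩
  obtain ⟨a, ha, ham, haP⟩ := hsep P hP
  obtain ⟨b, hb, hbm, hbQ⟩ := hsep Q hQ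
  obtain ⟨q, hq, hcq, hqm, hmin⟩ := hm.exists_minimal
    (sup_le (sup_le (hfp.trans hlt.le) ham) hbm)
  have hcc := isCompactElement_sup (isCompactElement_sup hfc ha) hb
  have key : ∀ p', IsPrimeElt p' → f ≤ p' → ¬ p' < q := fun p' hp' hfp' =>
    not_lt_of_isCTAFL hC hpg hdom hCTA hp' hq (fun h => hf0 (le_bot_iff.1 (h ▸ hfp'))) hcc hcq hmin
  have hfq : f ≤ q := le_sup_left.trans (le_sup_left.trans hcq)
  have hrq : r ≤ q := hq.le_of_mul_self_le (hrr.trans hfq)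
  have hqeq : q = m := by
    rcases hq.2 _ _ (hPQ.trans hrq) with h | h
    · obtain rfl := eq_of_le_of_not_lt h (key P hP (hfr.trans hrP))
      exact haP (le_sup_right.trans (le_sup_left.trans hcq))
    · obtain rfl := eq_of_le_of_not_lt h (key Q hQ (hfr.trans hrQ))
      exact hbQ (le_sup_right.trans hcq)
  exact key p hp hfp (hqeq ▸ hlt)

end Dimension

/-! ### Dimension at most one: powers of the maximal element -/

section QuasiLocal

variable {L : Type*} [CommMonoid L] [CompleteLattice L] [IsMultiplicativeLattice L] {m : L}

theorem IsQuasiLocal.le (hloc : IsQuasiLocal L m) {a : L} (ha : a < ⊤) : a ≤ m := by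
  have h1 := hloc.1
  rw [one_eq_top] at h1
  have := CompleteLattice.coatomic_of_top_compact h1
  obtain ⟨n, hn, han⟩ := (eq_top_or_exists_le_coatom a).resolve_left ha.ne
  exact hloc.2.2 n hn ▸ han

theorem IsQuasiLocal.isPrimeElt (hloc : IsQuasiLocal L m) : IsPrimeElt m := by
  refine ⟨hloc.2.1.lt_top, fun a b h => ?_⟩
  by_contra! hcon
  have ha : a = ⊤ := by_contra fun h => hcon.1 (hloc.le (lt_top_iff_ne_top.2 h))
  have hb : b = ⊤ := by_contra fun h => hcon.2 (hloc.le (lt_top_iff_ne_top.2 h))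
  rw [ha, hb, top_mul] at h
  exact hloc.2.1.lt_top.not_ge h

theorem IsQuasiLocal.isOAElt (hloc : IsQuasiLocal L m) {x : L} (h1 : m * m ≤ x) (h2 : x ≤ m) :
    IsOAElt x := by
  refine ⟨h2.trans_lt hloc.2.1.lt_top, fun a b c ha hb _ _ => .inl (le_trans ?_ h1)⟩
  exact mul_le_mul' (hloc.le (lt_top_iff_ne_top.2 ha)) (hloc.le (lt_top_iff_ne_top.2 hb))

omit [IsMultiplicativeLattice L] in
theorem IsPrimeElt.isOAElt {p : L} (hp : IsPrimeElt p) : IsOAElt p :=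
  ⟨hp.1, fun _ _ _ _ _ _ h => hp.2 _ _ h⟩

theorem IsQuasiLocal.dim_le_one_iff (hloc : IsQuasiLocal L m) (hdom : IsLatticeDomain L) :
    dim L ≤ 1 ↔ ∀ p : L, IsPrimeElt p → p = ⊥ ∨ p = m := by
  rw [dim, Order.krullDim_le_one_iff]
  constructor
  · intro h p hp
    rcases h ⟨p, hp⟩ with h | h
    · left
      exact le_bot_iff.1 (h (b := ⟨⊥, hdom⟩) (bot_le (a := p)))
    · right
      exact le_antisymm (hloc.le hp.1) (h (b := ⟨m, hloc.isPrimeElt⟩) (hloc.le hp.1))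
  · rintro h ⟨p, hp⟩
    rcases h p hp with rfl | rfl
    · exact .inl fun b _ => (bot_le : ⊥ ≤ b.1)
    · exact .inr fun b _ => hloc.le b.2.1

omit [IsMultiplicativeLattice L] in
theorem accOnPrimes_of_forall_eq (h : ∀ p : L, IsPrimeElt p → p = ⊥ ∨ p = m) :
    ACCOnPrimes L := by
  intro f hf hmono
  by_cases hex : ∃ n, f n ≠ ⊥
  · obtain ⟨n, hn⟩ := hex
    refine ⟨n, fun k hk => ?_⟩
    have hk0 : f k ≠ ⊥ := fun h0 => hn (le_bot_iff.1 (h0 ▸ hmono hk))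
    rw [(h _ (hf n)).resolve_left hn, (h _ (hf k)).resolve_left hk0]
  · push Not at hex
    exact ⟨0, fun k _ => by rw [hex, hex]⟩

/-- The only prime above `y` is `m`, and localizing at `m` changes nothing, since an element not
below `m` is `⊤`. -/
theorem IsTAElt.sq_le_of_ne_bot (hloc : IsQuasiLocal L m)
    (hdim : ∀ p : L, IsPrimeElt p → p = ⊥ ∨ p = m) {y : L} (hy : IsTAElt y) (hy0 : y ≠ ⊥) :
    m * m ≤ y := by
  have hm := hloc.isPrimeElt
  refine (hy.mul_self_le_loc hm (hloc.le hy.1) fun P hP hyP _ =>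
    (hdim P hP).resolve_left fun h => hy0 (le_bot_iff.1 (h ▸ hyP))).trans ?_
  refine sSup_le fun u ⟨s, hs, hu⟩ => ?_
  have : s = ⊤ := by_contra fun h => hs (hloc.le (lt_top_iff_ne_top.2 h))
  rwa [this, top_mul] at hu

theorem exists_pow_le_prod (s : Multiset L) (hs : ∀ y ∈ s, m * m ≤ y ∧ y ≤ m) :
    m ^ (2 * s.card) ≤ s.prod ∧ s.prod ≤ m ^ s.card := by
  induction s using Multiset.induction with
  | empty => simp
  | cons y s ih =>
    obtain ⟨h1, h2⟩ := ih fun z hz => hs z (by simp [hz])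
    obtain ⟨h3, h4⟩ := hs y (by simp)
    rw [Multiset.prod_cons, Multiset.card_cons]
    constructor
    · rw [mul_add, mul_one, pow_add, mul_comm, pow_two]; exact mul_le_mul' h3 h1
    · rw [pow_succ']; exact mul_le_mul' h4 h2

theorem isComparableElt_sq_and_iInf_pow_eq_bot (hpg : IsPrincipallyGenerated L)
    (hdom : IsLatticeDomain L) (hloc : IsQuasiLocal L m)
    (hdim : ∀ p : L, IsPrimeElt p → p = ⊥ ∨ p = m) (hP : IsPTAFL L) :
    IsComparableElt (m ^ 2) ∧ (⨅ n : ℕ, m ^ n) = ⊥ := by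
  have hm := hloc.isPrimeElt
  by_cases hm0 : m = ⊥
  · refine ⟨fun b => .inl ?_, le_bot_iff.1 ((iInf_le _ 1).trans (by rw [pow_one, hm0]))⟩
    rw [pow_two, hm0, Quantale.bot_mul]; exact bot_le
  have hfac : ∀ f : L, IsPrincipalElt f → f ≠ ⊥ → f ≤ m →
      ∃ k, 0 < k ∧ m ^ (2 * k) ≤ f ∧ f ≤ m ^ k := by
    intro f hf hf0 hfm
    obtain ⟨s, hs, rfl⟩ := hP f hf
    obtain ⟨h1, h2⟩ := exists_pow_le_prod (m := m) s fun y hy =>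
      ⟨(hs y hy).sq_le_of_ne_bot hloc hdim fun h =>
        hf0 (le_bot_iff.1 (h ▸ prod_le_of_mem hy)), hloc.le (hs y hy).1⟩
    refine ⟨_, Multiset.card_pos.2 fun h => ?_, h1, h2⟩
    rw [h, Multiset.prod_zero, one_eq_top] at hfm
    exact hm.1.not_ge hfm
  constructor
  · intro b
    by_contra! hcon
    obtain ⟨f, hf, hfb, hfm⟩ := exists_not_le (hpg b) hcon.2
    have hf1 : f ≤ m := by
      refine hloc.le (lt_top_iff_ne_top.2 fun h => hcon.1 ?_)
      exact le_top.trans (h ▸ hfb)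
    obtain ⟨k, hk, h1, h2⟩ := hfac f hf (fun h => hfm (h ▸ bot_le)) hf1
    have : k = 1 := by
      by_contra hne
      obtain ⟨i, rfl⟩ := Nat.exists_eq_add_of_le (show 2 ≤ k by omega)
      rw [pow_add] at h2
      exact hfm (h2.trans (mul_le_left _ _))
    subst this
    exact hcon.1 (h1.trans hfb)
  · by_contra hne
    obtain ⟨f, hf, hfi, hf0⟩ := exists_not_le (hpg (⨅ n : ℕ, m ^ n)) (b := ⊥)
      (fun h => hne (le_bot_iff.1 h))
    replace hf0 : f ≠ ⊥ := fun h => hf0 h.le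
    have hall : ∀ n, f ≤ m ^ n := fun n => hfi.trans (iInf_le _ n)
    obtain ⟨k, hk, h1, h2⟩ := hfac f hf hf0 (by simpa using hall 1)
    have : ⊤ ≤ m := by
      refine hf.2.le_of_mul_le_mul hdom hf0 ?_
      rw [top_mul]
      -- One exponent more than `2 * k` yields `f ≤ m * m ^ (2 * k) ≤ m * f`.
      refine (hall (2 * k + 1)).trans ?_
      rw [pow_succ']
      exact mul_le_mul' le_rfl h1
    exact hm.1.not_ge this

theorem isOAFL_of_isComparableElt_sq (hpg : IsPrincipallyGenerated L)
    (hdom : IsLatticeDomain L) (hloc : IsQuasiLocal L m) (hcomp : IsComparableElt (m ^ 2))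
    (hinf : (⨅ n : ℕ, m ^ n) = ⊥) : IsOAFL L := by
  intro x
  by_cases hx0 : x = ⊥
  · exact ⟨{x}, by simpa [hx0] using hdom.isOAElt, by simp⟩
  by_cases hx1 : x = ⊤
  · exact ⟨0, by simp, by simp [hx1, one_eq_top]⟩
  have hxm := hloc.le (lt_top_iff_ne_top.2 hx1)
  have hex : ∃ n, ¬ x ≤ m ^ n := by
    by_contra! h
    exact hx0 (le_bot_iff.1 (hinf ▸ le_iInf h))
  classical
  have hfind := Nat.find_spec hex
  have hmin := fun k => @Nat.find_min _ _ hex k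
  set N := Nat.find hex
  have hN : 2 ≤ N := by
    by_contra! h
    interval_cases N
    · simp [one_eq_top] at hfind
    · simp [hxm] at hfind
  -- With `N = n + 2`, `x` lies below `m ^ (n + 1)` but not below `m ^ (n + 2)`.
  obtain ⟨n, hn⟩ := Nat.exists_eq_add_of_le' hN
  have hxn : x ≤ m ^ (n + 1) := not_not.1 (hmin (n + 1) (by omega))
  rw [hn] at hfind
  have hmm : ¬ m ≤ m ^ 2 := by
    intro h
    apply hfind
    refine hxn.trans ?_
    rw [pow_succ, pow_add]
    exact mul_le_mul' le_rfl h
  obtain ⟨e, he, hem, hemm⟩ := exists_not_le (hpg m) hmm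
  have he0 : e ≠ ⊥ := fun h => hemm (h ▸ bot_le)
  have hme : m ^ 2 ≤ e := (hcomp e).resolve_right hemm
  -- Meet-principality writes `m ^ 2 = (m ^ 2 : e) * e`, and this residual is proper because `e` is
  -- not below `m ^ 2`.
  have hm2 : m * m ≤ m * e := by
    rw [← pow_two, he.1.eq_residual_mul hme]
    refine mul_le_mul' (hloc.le (lt_top_iff_ne_top.2 fun h => hemm ?_)) le_rfl
    have := residual_mul_le (m ^ 2) e
    rwa [h, top_mul] at this
  have hmpow : ∀ n, m ^ (n + 1) ≤ m * e ^ n := by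
    intro n
    induction n with
    | zero => simp
    | succ n ih =>
      calc m ^ (n + 1 + 1) = m ^ (n + 1) * m := pow_succ _ _
        _ ≤ m * e ^ n * m := mul_le_mul' ih le_rfl
        _ = m * m * e ^ n := by ac_rfl
        _ ≤ m * e * e ^ n := mul_le_mul' hm2 le_rfl
        _ = m * e ^ (n + 1) := by rw [pow_succ', mul_assoc]
  obtain ⟨y, hy⟩ := he.exists_eq_mul_pow hdom he0 ((hxn.trans (hmpow n)).trans (mul_le_right _ _))
  have heOA : IsOAElt e := hloc.isOAElt (by rwa [← pow_two]) hem
  by_cases hy1 : y = ⊤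
  · refine ⟨Multiset.replicate n e, fun z hz => ?_, ?_⟩
    · rw [Multiset.eq_of_mem_replicate hz]; exact heOA
    · rw [Multiset.prod_replicate, hy, hy1, top_mul]
  have hyOA : IsOAElt y := by
    refine hloc.isOAElt ?_ (hloc.le (lt_top_iff_ne_top.2 hy1))
    rw [← pow_two]
    -- If `y ≤ m ^ 2`, then `x = y * e ^ n ≤ m ^ (n + 2)`, against the choice of `n`.
    refine (hcomp y).resolve_right fun h => hfind ?_
    rw [hy, add_comm, pow_add]
    exact mul_le_mul' h (pow_le_pow_left' hem n)
  refine ⟨y ::ₘ Multiset.replicate n e, fun z hz => ?_, ?_⟩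
  · rcases Multiset.mem_cons.1 hz with rfl | hz
    · exact hyOA
    · rw [Multiset.eq_of_mem_replicate hz]; exact heOA
  · rw [Multiset.prod_cons, Multiset.prod_replicate, hy]

end QuasiLocal

end MultLattice

/-! ### The equivalences -/

theorem theorem4p15 (L : Type*) [CommMonoid L] [CompleteLattice L] [IsMultiplicativeLattice L]
    (m : L) (hC : MultLattice.IsCLattice L) (hpg : MultLattice.IsPrincipallyGenerated L)
    (hdom : MultLattice.IsLatticeDomain L) (hloc : MultLattice.IsQuasiLocal L m) :
    List.TFAE [
      MultLattice.IsOAFL L,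
      MultLattice.IsTAFL L,
      MultLattice.IsCOAFL L,
      MultLattice.IsCTAFL L ∧ MultLattice.ACCOnPrimes L,
      MultLattice.dim L ≤ 1 ∧ MultLattice.IsPOAFL L,
      MultLattice.dim L ≤ 1 ∧ MultLattice.IsPTAFL L,
      MultLattice.dim L ≤ 1 ∧ MultLattice.IsComparableElt (m ^ 2) ∧ (⨅ n : ℕ, m ^ n) = ⊥] := by
  have hdim := hloc.dim_le_one_iff hdom
  have hTA : ∀ x : L, MultLattice.HasFactorization MultLattice.IsOAElt x →
      MultLattice.HasFactorization MultLattice.IsTAElt x :=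
    fun x hx => hx.mono fun _ hy => hy.isTAElt
  have hCTA : MultLattice.IsCTAFL L → MultLattice.dim L ≤ 1 ∧ MultLattice.IsPTAFL L :=
    fun h => ⟨hdim.2 fun _ hp => MultLattice.eq_bot_or_eq_of_isCTAFL hC hpg hdom h
      hloc.isPrimeElt (fun _ => hloc.le) hp,
      fun x hx => h x (hC.isCompactElement_of_isPrincipalElt hx)⟩
  tfae_have 1 → 2 := fun h x => hTA x (h x)
  tfae_have 1 → 3 := fun h x _ => h x
  tfae_have 2 → 6 := fun h => hCTA fun x _ => h x
  tfae_have 3 → 6 := fun h => hCTA fun x hx => hTA x (h x hx)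
  tfae_have 4 → 6 := fun h => hCTA h.1
  tfae_have 5 → 6 := fun h => ⟨h.1, fun x hx => hTA x (h.2 x hx)⟩
  tfae_have 6 → 7 := fun h =>
    ⟨h.1, MultLattice.isComparableElt_sq_and_iInf_pow_eq_bot hpg hdom hloc (hdim.1 h.1) h.2⟩
  have hOA : MultLattice.dim L ≤ 1 ∧ MultLattice.IsComparableElt (m ^ 2) ∧
      (⨅ n : ℕ, m ^ n) = ⊥ → MultLattice.IsOAFL L := fun h =>
    MultLattice.isOAFL_of_isComparableElt_sq hpg hdom hloc h.2.1 h.2.2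
  tfae_have 7 → 1 := hOA
  tfae_have 7 → 4 := fun h =>
    ⟨fun x _ => hTA x (hOA h x), MultLattice.accOnPrimes_of_forall_eq (hdim.1 h.1)⟩
  tfae_have 7 → 5 := fun h => ⟨h.1, fun x _ => hOA h x⟩
  tfae_finish
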